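/- Consider $n$ parallel queues in discrete time. In slot $t$, $A(t)\in\mathbb{N}$ jobs arrive; the $A(t)$ are i.i.d., bounded, with mean $n\lambda$. All of them join the queue $I^*(t)$ chosen by the dispatcher, and then server $l$ serves up to $S_l(t)\in\mathbb{N}$ jobs, where the vectors $\mathbf S(t)$ are i.i.d., bounded, independent of the arrivals, with $\mathbb{E}[S_l(t)]=\mu_l>0$. Thus $Q_l(t+1)=\big[Q_l(t)+A(t)\mathbf 1\{I^*(t)=l\}-S_l(t)\big]^+$. A policy $\pi$ is given by an integer $T\ge 1$, a vector $\boldsymbol\gamma\in(0,\infty)^n$, a sorting function $L:\mathbb{R}_+^n\times[0,1]\to\mathcal S_n$ and a decision function $Y:\mathcal S_n\times(0,\infty)^n\times[0,1]\to [n]^T$, where $\eta=L(\mathbf o,v)$ always satisfies $o_{\eta(1)}\ge\dots\ge o_{\eta(n)}$. At each time $kT$ the queues are sampled, $\eta_k=L\big((Q_l(kT)/\gamma_l)_l,V_k\big)$ is formed, and the destinations for the slots $kT,\dots,(k+1)T-1$ are $\phi(k)=Y(\eta_k,\boldsymbol\mu,W_k)$; here $V_k,W_k$ are independent uniform variables on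 $[0,1]$, independent of everything else. The state of the system at time $t$ is the Markov chain $\mathbf X(t)=\big(\mathbf Q(t),\phi(\lfloor t/T\rfloor),\,t-T\lfloor t/T\rfloor\big)$. For $\eta\in\mathcal S_n$ and $l\in[n]$ let $$f_{l,\eta}=\mathbb{E}\Big[\tfrac1T\,\#\{j\in[T]: Y(\eta,\boldsymbol\mu,W)_j=\eta(l)\}\Big],\qquad W\sim\mathrm{Unif}[0,1],$$ the expected fraction of slots of a cycle whose arrivals are sent to the $l$-th longest scaled queue when the sampled permutation is $\eta$. **Corollary.** Suppose that $$\sum_{l=1}^m f_{l,\eta}\le\frac{\sum_{l=1}^m\mu_{\eta(l)}}{\sum_{l=1}^n\mu_{\eta(l)}}\qquad\text{for all } m\in[n],\ \eta\in\mathcal S_n .$$ Then $\pi$ is throughput optimal: for every $\lambda\ge0$ with $n\lambda<\sum_{l=1}^n\mu_l$, and every bounded arrival law with mean $n\lambda$, the Markov chain $\{\mathbf X(t)\}$ is positive recurrent. Here, irreducibility not being presupposed, positive recurrent means that every state of every closed communicating class has a finite mean return time, and that from every initial state the chain reaches a state with finite mean return time in finite expected time; for an irreducible chain this says that all states have finite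 mean return times. -/

import Mathlib

open MeasureTheory
open scoped ENNReal NNReal unitInterval

noncomputable section

namespace LoadBalancing

/-! ### Markov chains given by a stochastic recursion

A time-homogeneous Markov chain on a state space `X` is given by an update map
`F : X → E → X` and the common law `ν` of the i.i.d. innovations `ω 0, ω 1, …`:
`X(t + 1) = F (X(t), ω t)`. -/

section MarkovChain

variable {X E : Type*} [MeasurableSpace E]

/-- The trajectory of the recursion `X(t + 1) = F (X(t), ω t)` started at `X(0) = x`. -/
def path (F : X → E → X) (x : X) (ω : ℕ → E) : ℕ → X
  | 0 => x
  | t + 1 => F (path F x ω t) (ω t)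

/-- The first time `t ≥ 1` at which the trajectory started at `x` is in `B`
(`∞` if there is no such time). -/
def hitTime (F : X → E → X) (x : X) (B : Set X) (ω : ℕ → E) : ℝ≥0∞ :=
  ⨅ t : {t : ℕ // 1 ≤ t ∧ path F x ω t ∈ B}, ((t : ℕ) : ℝ≥0∞)

/-- The expected value of the first time `t ≥ 1` at which the chain started at `x` is in `B`. -/
def meanHitTime (F : X → E → X) (ν : Measure E) [IsProbabilityMeasure ν]
    (x : X) (B : Set X) : ℝ≥0∞ :=
  ∫⁻ ω, hitTime F x B ω ∂(Measure.infinitePi fun _ : ℕ => ν)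

/-- `y` is accessible from `x`: the chain started at `x` is at `y` with positive probability
at some time `t ≥ 0`. -/
def Accessible (F : X → E → X) (ν : Measure E) [IsProbabilityMeasure ν] (x y : X) : Prop :=
  ∃ t : ℕ, 0 < (Measure.infinitePi fun _ : ℕ => ν) {ω | path F x ω t = y}

/-- `x` is essential, that is, it lies in a closed communicating class: it is accessible from
every state that is accessible from it. In an irreducible chain every state is essential. -/
def Essential (F : X → E → X) (ν : Measure E) [IsProbabilityMeasure ν] (x : X) : Prop :=
  ∀ y, Accessible F ν x y → Accessible F ν y x

/-- `x` is a positive recurrent state: its mean return time is finite. -/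
def PositiveRecurrentState (F : X → E → X) (ν : Measure E) [IsProbabilityMeasure ν]
    (x : X) : Prop :=
  meanHitTime F ν x {x} < ∞

/-- The chain is positive recurrent: every state of every closed communicating class has a finite
mean return time, and from every initial state the chain reaches a positive recurrent state in
finite expected time. If the chain is irreducible, then this says exactly that all states have
finite mean return times; irreducibility is not presupposed. -/
def PositiveRecurrent (F : X → E → X) (ν : Measure E) [IsProbabilityMeasure ν] : Prop :=
  (∀ x, Essential F ν x → PositiveRecurrentState F ν x) ∧
    ∀ x, meanHitTime F ν x {y | PositiveRecurrentState F ν y} < ∞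

end MarkovChain

/-! ### Dispatching policies -/

/-- A dispatching policy for `n` servers. Servers are indexed by `Fin n`. A unit vector `e_j` is
represented by its index `j`, so that a sequence of `T` decision vectors is a map
`Fin T → Fin n`. -/
structure Policy (n : ℕ) where
  /-- length of a dispatching cycle: queue lengths are sampled every `T` slots -/
  T : ℕ
  T_pos : 0 < T
  /-- scaling of the queue lengths -/
  γ : Fin n → ℝ≥0
  γ_pos : ∀ l, 0 < γ l
  /-- sorting function: from the scaled queue lengths and a randomization variable to a
  permutation of the servers -/
  L : (Fin n → ℝ≥0) → I → Equiv.Perm (Fin n)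
  L_measurable : ∀ (o : Fin n → ℝ≥0) (η : Equiv.Perm (Fin n)), MeasurableSet {v | L o v = η}
  /-- the scaled queue lengths are arranged in decreasing order -/
  L_sorted : ∀ (o : Fin n → ℝ≥0) (v : I) (i j : Fin n), i ≤ j → o (L o v j) ≤ o (L o v i)
  /-- decision function: from the permutation, the service rates and a randomization variable
  to the decisions for the `T` slots of the cycle -/
  Y : Equiv.Perm (Fin n) → (Fin n → ℝ) → I → Fin T → Fin n
  Y_measurable : ∀ (η : Equiv.Perm (Fin n)) (μ : Fin n → ℝ) (φ : Fin T → Fin n), MeasurableSet {w | Y η μ w = φ}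

namespace Policy

variable {n : ℕ} (π : Policy n)

/-- The number of slots of a cycle in which arrivals are sent to the server `η l` (the one with
the `l`-th longest scaled queue), when the sampled permutation is `η` and the randomization
variable of the decision function is `w`. -/
def slotCount (μ : Fin n → ℝ) (η : Equiv.Perm (Fin n)) (w : I) (l : Fin n) : ℕ :=
  (Finset.univ.filter fun j : Fin π.T => π.Y η μ w j = η l).card

/-- `f_{l,η}`: the expected fraction of the slots of a cycle in which arrivals are sent to the
`l`-th longest scaled queue, given that the sampled permutation is `η`. The decisions depend on
the past only through `η`, and `w` is uniform on `[0,1]` and independent of `η`. -/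
def f (μ : Fin n → ℝ) (l : Fin n) (η : Equiv.Perm (Fin n)) : ℝ :=
  ∫ w : I, (π.slotCount μ η w l : ℝ) / π.T

/-- State `(Q(t), φ(⌊t/T⌋), t - ⌊t/T⌋ T)`: queue lengths, decisions of the current cycle, and
position in the current cycle. -/
abbrev State : Type := (Fin n → ℕ) × (Fin π.T → Fin n) × Fin π.T

/-- What is random in one slot: the number of arrivals, the potential services, and the
randomization variables of the sorting and decision functions (used only if a new cycle
starts). -/
abbrev Input (n : ℕ) : Type := ℕ × (Fin n → ℕ) × I × I

/-- The decisions of a cycle that starts with queue lengths `q`. -/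
def decide (μ : Fin n → ℝ) (q : Fin n → ℕ) (v w : I) : Fin π.T → Fin n :=
  π.Y (π.L (fun l => (q l : ℝ≥0) / π.γ l) v) μ w

/-- `[q + a e_j - s]⁺`; the subtraction of natural numbers is truncated at `0`. -/
def nextQueue (q : Fin n → ℕ) (j : Fin n) (a : ℕ) (s : Fin n → ℕ) : Fin n → ℕ :=
  fun l => q l + (if l = j then a else 0) - s l

/-- One slot of the system: all arrivals join the queue chosen for this slot, then the servers
serve; at the end of a cycle the queues are sampled and the decisions of the next cycle are
drawn. -/
def step (μ : Fin n → ℝ) (x : π.State) (ξ : Input n) : π.State :=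
  let q := nextQueue x.1 (x.2.1 x.2.2) ξ.1 ξ.2.1
  if h : (x.2.2 : ℕ) + 1 < π.T then (q, x.2.1, ⟨x.2.2 + 1, h⟩)
  else (q, π.decide μ q ξ.2.2.1 ξ.2.2.2, ⟨0, π.T_pos⟩)

/-- The law of the input of one slot: arrivals of law `α`, services of law `β`, and two uniform
variables on `[0,1]`, all independent (services of different servers may be dependent). -/
def inputLaw (α : Measure ℕ) (β : Measure (Fin n → ℕ)) : Measure (Input n) :=
  α.prod (β.prod ((volume : Measure I).prod (volume : Measure I)))

instance (α : Measure ℕ) (β : Measure (Fin n → ℕ)) [IsProbabilityMeasure α]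
    [IsProbabilityMeasure β] : IsProbabilityMeasure (inputLaw α β) := by
  unfold inputLaw; infer_instance

/-- Throughput optimality for service rates `μ` and service law `β`: for every
`λ ≥ 0` with `n λ < ∑ μ_l` and every law `α` of the number of arrivals per slot that is
bounded and has mean `n λ`, the Markov chain of the system is positive recurrent. -/
def ThroughputOptimal (μ : Fin n → ℝ) (β : Measure (Fin n → ℕ)) [IsProbabilityMeasure β] :
    Prop :=
  ∀ lam : ℝ, 0 ≤ lam → (n : ℝ) * lam < ∑ l, μ l →
    ∀ (α : Measure ℕ) [IsProbabilityMeasure α],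
      (∃ c : ℕ, ∀ᵐ a ∂α, a ≤ c) → ∫ a, (a : ℝ) ∂α = n * lam →
        PositiveRecurrent (π.step μ) (inputLaw α β)

end Policy

end LoadBalancing

end

/-! The proof is a Foster–Lyapunov argument run slot by slot, although the dispatcher acts only once
per cycle. To the weighted squares `q l ^ 2 / γ l`, the function `lyapunov` adds a cross term with
the input the current cycle still has to deliver, raised by `δ` per slot. Inside a cycle, the
expected growth of the squares is paid for by the loss of one slot from this correction. Up to a
constant, what is left is `-2δ` times the total scaled queue length.

When a cycle ends, the old correction is exhausted and one for a full cycle appears. Its mean over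
the decision variable is nonpositive (`integral_sum_netInput_nonpos`). The sampled order makes the
scaled queue lengths antitone, so Abel summation reduces the claim to prefix sums, and these are
controlled by the hypothesis on `f`. Spare capacity leaves room for a positive `δ`.

`integral_lyapunov_step_le` thus gives drift at most `-1` outside a finite set. Since irreducibility
is not assumed, `positiveRecurrent_of_drift` has to pass from hitting a finite set to positive
recurrence. Mean hitting times are least supersolutions of the first-step inequalities, and points
from which the rest of the target is accessible are deleted from the target one at a time
(`meanHitTime_lt_top_of_insert`). -/

namespace LoadBalancing

/-! ### Splitting off the first term of an i.i.d. sequence -/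

section Shift

variable {E : Type*} [MeasurableSpace E]

/-- The sequence that starts with `e` and goes on as `ω`. -/
def consSeq (e : E) (ω : ℕ → E) : ℕ → E
  | 0 => e
  | t + 1 => ω t

theorem measurable_consSeq : Measurable fun p : E × (ℕ → E) => consSeq p.1 p.2 := by
  refine measurable_pi_iff.2 fun t => ?_
  cases t with
  | zero => exact measurable_fst
  | succ t => exact (measurable_pi_apply t).comp measurable_snd

/-- An infinite product measure is determined by finite cylinders. The preimage of a cylinder is a
condition on the first term times a shifted cylinder. -/
theorem map_consSeq (ν : Measure E) [IsProbabilityMeasure ν] :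
    (ν.prod (Measure.infinitePi fun _ : ℕ => ν)).map (fun p => consSeq p.1 p.2) =
      Measure.infinitePi fun _ : ℕ => ν := by
  classical
  refine Measure.eq_infinitePi (fun _ : ℕ => ν) fun s t ht => ?_
  have hinj : Set.InjOn Nat.succ (Nat.succ ⁻¹' (s : Set ℕ)) := Nat.succ_injective.injOn
  set s' : Finset ℕ := s.preimage Nat.succ hinj with hs'
  -- The constraint on coordinate `0`, trivial if the cylinder does not involve it.
  set A : Set E := if 0 ∈ s then t 0 else Set.univ with hA
  have hpre : (fun p : E × (ℕ → E) => consSeq p.1 p.2) ⁻¹' (Set.pi s t) =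
      A ×ˢ Set.pi s' fun i => t (i + 1) := by
    ext ⟨e, ω⟩
    simp only [Set.mem_preimage, Set.mem_pi, Finset.mem_coe, Set.mem_prod]
    constructor
    · intro h
      refine ⟨?_, fun i hi => h (i + 1) (by simpa [hs'] using hi)⟩
      by_cases h0 : 0 ∈ s
      · simp only [hA, if_pos h0]
        exact h 0 h0
      · simp [hA, h0]
    · rintro ⟨h1, h2⟩ i hi
      cases i with
      | zero =>
        simp only [hA, if_pos hi] at h1
        exact h1
      | succ i => exact h2 i (by simpa [hs'] using hi)
  have hm : MeasurableSet (Set.pi (s : Set ℕ) t) :=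
    MeasurableSet.pi s.countable_toSet fun i _ => ht i
  rw [Measure.map_apply measurable_consSeq hm, hpre, Measure.prod_prod,
    Measure.infinitePi_pi _ (fun i _ => ht (i + 1))]
  have hsplit : ∏ i ∈ s, ν (t i) = (if 0 ∈ s then ν (t 0) else 1) * ∏ i ∈ s', ν (t (i + 1)) := by
    have h1 : ∏ i ∈ s', ν (t (i + 1)) = ∏ i ∈ s.erase 0, ν (t i) := by
      refine Finset.prod_bij (fun i _ => i + 1) ?_ ?_ ?_ ?_
      · intro i hi
        simpa [hs'] using hi
      · intro i _ j _ h
        exact Nat.succ_injective h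
      · intro j hj
        obtain ⟨h0, hj⟩ := Finset.mem_erase.1 hj
        obtain ⟨k, rfl⟩ := Nat.exists_eq_succ_of_ne_zero h0
        exact ⟨k, by simpa [hs'] using hj, rfl⟩
      · intro i _
        rfl
    rw [h1]
    split_ifs with h0
    · exact (Finset.mul_prod_erase s (fun i => ν (t i)) h0).symm
    · rw [Finset.erase_eq_of_notMem h0, one_mul]
  rw [hsplit]
  congr 1
  by_cases h0 : 0 ∈ s <;> simp [hA, h0]

theorem lintegral_consSeq (ν : Measure E) [IsProbabilityMeasure ν] {g : (ℕ → E) → ℝ≥0∞}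
    (hg : Measurable g) :
    ∫⁻ ω, g ω ∂(Measure.infinitePi fun _ : ℕ => ν) =
      ∫⁻ e, ∫⁻ ω, g (consSeq e ω) ∂(Measure.infinitePi fun _ : ℕ => ν) ∂ν := by
  conv_lhs => rw [← map_consSeq ν, lintegral_map hg measurable_consSeq]
  exact lintegral_prod _ (hg.comp measurable_consSeq).aemeasurable

end Shift

theorem measurable_comp_of_countable {Ω X β : Type*} [MeasurableSpace Ω] [Countable X]
    [MeasurableSpace β] {f : Ω → X} (hf : ∀ y, MeasurableSet {ω | f ω = y}) (h : X → β) :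
    Measurable fun ω => h (f ω) := by
  let _ : MeasurableSpace X := ⊤
  have : Measurable f := measurable_to_countable' hf
  exact (measurable_from_top (f := h)).comp this

theorem integrable_comp_of_ae_mem_finite {Ω X : Type*} [MeasurableSpace Ω] [Countable X]
    {P : Measure Ω} [IsFiniteMeasure P] {f : Ω → X} (hf : ∀ y, MeasurableSet {ω | f ω = y})
    {S : Set X} (hS : S.Finite) (hfS : ∀ᵐ ω ∂P, f ω ∈ S) (h : X → ℝ) :
    Integrable (fun ω => h (f ω)) P := by
  obtain ⟨b, hb⟩ := (hS.image fun x => ‖h x‖).bddAbove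
  refine Integrable.of_bound (measurable_comp_of_countable hf h).aestronglyMeasurable b ?_
  filter_upwards [hfS] with ω hω
  exact hb ⟨f ω, hω, rfl⟩

/-! ### First-step analysis of hitting times -/

section Chain

variable {X E : Type*} {F : X → E → X}

theorem path_consSeq (F : X → E → X) (x : X) (e : E) (ω : ℕ → E) (t : ℕ) :
    path F x (consSeq e ω) (t + 1) = path F (F x e) ω t := by
  induction t with
  | zero => rfl
  | succ t ih =>
    rw [path, ih]
    rfl

open Classical in
theorem hitTime_eq (F : X → E → X) (x : X) (B : Set X) (ω : ℕ → E) :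
    hitTime F x B ω = ⨅ t : ℕ, if 1 ≤ t ∧ path F x ω t ∈ B then (t : ℝ≥0∞) else ⊤ := by
  rw [hitTime, iInf_subtype]
  refine iInf_congr fun t => ?_
  split_ifs with h <;> simp [h]

/-- Time `0` does not count as a hit. A first step into `B` therefore gives exactly `1`, and
otherwise the clock restarts at the new state. -/
theorem hitTime_consSeq (F : X → E → X) (x : X) (B : Set X) (e : E) (ω : ℕ → E) :
    hitTime F x B (consSeq e ω) =
      1 + Bᶜ.indicator (fun y => hitTime F y B ω) (F x e) := by
  by_cases hB : F x e ∈ B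
  · rw [Set.indicator_of_notMem (by simpa using hB), add_zero]
    refine le_antisymm ?_ ?_
    · exact iInf_le_of_le ⟨1, le_rfl, by simpa [path, consSeq] using hB⟩ (by simp)
    · refine le_iInf fun t => ?_
      exact_mod_cast t.2.1
  · rw [Set.indicator_of_mem (by simpa using hB), hitTime, hitTime, ENNReal.add_iInf]
    refine le_antisymm (le_iInf fun t => ?_) (le_iInf fun t => ?_)
    · refine iInf_le_of_le ⟨(t : ℕ) + 1, by omega, ?_⟩ ?_
      · rw [path_consSeq]
        exact t.2.2
      · push_cast
        exact (add_comm _ _).le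
    · obtain ⟨t, ht, hp⟩ := t
      obtain ⟨k, rfl⟩ := Nat.exists_eq_succ_of_ne_zero (by omega : t ≠ 0)
      rw [Nat.succ_eq_add_one, path_consSeq] at hp
      rcases Nat.eq_zero_or_pos k with rfl | hk
      · exact absurd hp hB
      · refine iInf_le_of_le ⟨k, hk, hp⟩ ?_
        push_cast
        rw [add_comm]

variable [MeasurableSpace E] {ν : Measure E}

/-- Almost surely, one step leads only to states that are reached with positive probability. -/
theorem ae_step_pos [Countable X] (x : X) : ∀ᵐ ξ ∂ν, 0 < ν {ζ | F x ζ = F x ξ} := by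
  refine measure_mono_null (t := ⋃ z ∈ {z | ν {ζ | F x ζ = z} = 0}, {ξ | F x ξ = z}) ?_ ?_
  · intro ξ hξ
    simp only [Set.mem_iUnion]
    exact ⟨F x ξ, by simpa using hξ, rfl⟩
  · exact (measure_biUnion_null_iff (Set.to_countable _)).2 fun z hz => hz

variable [IsProbabilityMeasure ν]

theorem meanHitTime_anti {B D : Set X} (h : B ⊆ D) (x : X) :
    meanHitTime F ν x D ≤ meanHitTime F ν x B :=
  lintegral_mono fun _ => le_iInf fun t => iInf_le_of_le ⟨t, t.2.1, h t.2.2⟩ le_rfl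

theorem meanHitTime_empty (x : X) : meanHitTime F ν x ∅ = ⊤ := by
  have : ∀ ω : ℕ → E, hitTime F x ∅ ω = ⊤ := fun ω => by
    rw [hitTime]
    have : IsEmpty {t : ℕ // 1 ≤ t ∧ path F x ω t ∈ (∅ : Set X)} := ⟨fun t => t.2.2⟩
    exact iInf_of_empty _
  simp [meanHitTime, this]

theorem Accessible.refl (x : X) : Accessible F ν x x :=
  ⟨0, by simp [path]⟩

variable [Countable X]

theorem measurable_comp_step (hF : ∀ x y, MeasurableSet {ξ | F x ξ = y}) {β : Type*}
    [MeasurableSpace β] (h : X → β) (x : X) : Measurable fun ξ => h (F x ξ) :=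
  measurable_comp_of_countable (hF x) h

theorem measurableSet_path_mem (hF : ∀ x y, MeasurableSet {ξ | F x ξ = y}) (x : X) (t : ℕ)
    (B : Set X) : MeasurableSet {ω : ℕ → E | path F x ω t ∈ B} := by
  let : MeasurableSpace X := ⊤
  have h1 : Measurable fun p : X × E => F p.1 p.2 :=
    measurable_from_prod_countable_right fun x => measurable_to_countable' fun y => hF x y
  have h2 : Measurable fun ω : ℕ → E => path F x ω t := by
    induction t with
    | zero => exact measurable_const
    | succ t ih => exact h1.comp (ih.prodMk (measurable_pi_apply t))
  exact h2 (MeasurableSpace.measurableSet_top (s := B))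

theorem measurable_hitTime (hF : ∀ x y, MeasurableSet {ξ | F x ξ = y}) (x : X) (B : Set X) :
    Measurable (hitTime F x B) := by
  classical
  have : hitTime F x B = fun ω => ⨅ t : ℕ,
      if 1 ≤ t ∧ path F x ω t ∈ B then (t : ℝ≥0∞) else ⊤ := funext fun ω => hitTime_eq F x B ω
  rw [this]
  refine Measurable.iInf fun t => Measurable.ite ?_ measurable_const measurable_const
  by_cases ht : 1 ≤ t
  · simpa [ht] using measurableSet_path_mem hF x t B
  · simp [ht]

theorem meanHitTime_eq (hF : ∀ x y, MeasurableSet {ξ | F x ξ = y}) (x : X) (B : Set X) :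
    meanHitTime F ν x B =
      1 + ∫⁻ ξ, Bᶜ.indicator (fun y => meanHitTime F ν y B) (F x ξ) ∂ν := by
  rw [meanHitTime, lintegral_consSeq ν (measurable_hitTime hF x B)]
  have h : ∀ ξ, ∫⁻ ω, hitTime F x B (consSeq ξ ω) ∂(Measure.infinitePi fun _ : ℕ => ν) =
      1 + Bᶜ.indicator (fun y => meanHitTime F ν y B) (F x ξ) := by
    intro ξ
    simp_rw [hitTime_consSeq]
    rw [lintegral_add_left measurable_const]
    congr 1
    · simp
    · by_cases hB : F x ξ ∈ Bᶜ
      · simp_rw [Set.indicator_of_mem hB]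
        rfl
      · simp_rw [Set.indicator_of_notMem hB]
        simp
  simp_rw [h]
  rw [lintegral_add_left measurable_const]
  simp

/-- The mean hitting times are the least solution of the first step inequalities. -/
theorem meanHitTime_le_of_supersolution (hF : ∀ x y, MeasurableSet {ξ | F x ξ = y}) {B : Set X}
    {h : X → ℝ≥0∞} (hh : ∀ x, 1 + ∫⁻ ξ, Bᶜ.indicator h (F x ξ) ∂ν ≤ h x) (x : X) :
    meanHitTime F ν x B ≤ h x := by
  -- Truncating at `N` makes induction possible: each step lowers the truncation level by one.
  -- Monotone convergence then removes it.
  have key : ∀ (N : ℕ) (x : X),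
      ∫⁻ ω, min (hitTime F x B ω) N ∂(Measure.infinitePi fun _ : ℕ => ν) ≤ h x := by
    intro N
    induction N with
    | zero =>
      intro x
      simp only [Nat.cast_zero, min_zero, lintegral_zero, zero_le]
    | succ N ih =>
      intro x
      rw [lintegral_consSeq ν ((measurable_hitTime hF x B).min measurable_const)]
      refine le_trans ?_ (hh x)
      have : 1 + ∫⁻ ξ, Bᶜ.indicator h (F x ξ) ∂ν =
          ∫⁻ ξ, (1 + Bᶜ.indicator h (F x ξ)) ∂ν := by
        rw [lintegral_add_left measurable_const]
        simp
      rw [this]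
      refine lintegral_mono fun ξ => ?_
      have h1 : ∀ ω, min (hitTime F x B (consSeq ξ ω)) ((N + 1 : ℕ) : ℝ≥0∞) ≤
          1 + Bᶜ.indicator (fun y => min (hitTime F y B ω) N) (F x ξ) := by
        intro ω
        rw [hitTime_consSeq]
        by_cases hB : F x ξ ∈ Bᶜ
        · simp_rw [Set.indicator_of_mem hB]
          push_cast
          rw [add_comm (N : ℝ≥0∞) 1, min_add_add_left]
        · simp_rw [Set.indicator_of_notMem hB]
          exact min_le_left _ _
      refine (lintegral_mono h1).trans ?_
      rw [lintegral_add_left measurable_const]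
      refine add_le_add (by simp) ?_
      by_cases hB : F x ξ ∈ Bᶜ
      · simp_rw [Set.indicator_of_mem hB]
        exact ih _
      · simp_rw [Set.indicator_of_notMem hB]
        simp
  have hsup : ∀ ω, hitTime F x B ω = ⨆ N : ℕ, min (hitTime F x B ω) N := by
    intro ω
    have := inf_iSup_eq (hitTime F x B ω) (fun N : ℕ => (N : ℝ≥0∞))
    rw [ENNReal.iSup_natCast] at this
    rwa [inf_top_eq] at this
  rw [meanHitTime, lintegral_congr hsup, lintegral_iSup (fun N => (measurable_hitTime hF x B).min measurable_const)]
  · exact iSup_le fun N => key N x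
  · intro N M hNM ω
    exact min_le_min_left _ (by exact_mod_cast hNM)

/-! ### Accessibility -/

theorem accessible_succ_iff (hF : ∀ x y, MeasurableSet {ξ | F x ξ = y}) (x y : X) (t : ℕ) :
    0 < (Measure.infinitePi fun _ : ℕ => ν) {ω | path F x ω (t + 1) = y} ↔
      ∃ z, 0 < ν {ξ | F x ξ = z} ∧
        0 < (Measure.infinitePi fun _ : ℕ => ν) {ω | path F z ω t = y} := by
  have hm : ∀ z s, MeasurableSet {ω : ℕ → E | path F z ω s = y} :=
    fun z s => measurableSet_path_mem hF z s {y}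
  have h1 : (Measure.infinitePi fun _ : ℕ => ν) {ω | path F x ω (t + 1) = y} =
      ∫⁻ ξ, (Measure.infinitePi fun _ : ℕ => ν) {ω | path F (F x ξ) ω t = y} ∂ν := by
    rw [← lintegral_indicator_one (hm x (t + 1)),
      lintegral_consSeq ν ((measurable_one).indicator (hm x (t + 1)))]
    refine lintegral_congr fun ξ => ?_
    rw [← lintegral_indicator_one (hm (F x ξ) t)]
    refine lintegral_congr fun ω => ?_
    have hp := path_consSeq F x ξ ω t
    by_cases h : path F (F x ξ) ω t = y
    · rw [Set.indicator_of_mem (show consSeq ξ ω ∈ {ω | path F x ω (t + 1) = y} from hp.trans h),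
        Set.indicator_of_mem (show ω ∈ {ω | path F (F x ξ) ω t = y} from h)]
      rfl
    · rw [Set.indicator_of_notMem
          (show consSeq ξ ω ∉ {ω | path F x ω (t + 1) = y} from fun h' => h (hp.symm.trans h')),
        Set.indicator_of_notMem (show ω ∉ {ω | path F (F x ξ) ω t = y} from h)]
  rw [h1, lintegral_pos_iff_support (measurable_comp_step hF
    (fun z => (Measure.infinitePi fun _ : ℕ => ν) {ω | path F z ω t = y}) x)]
  constructor
  · intro h
    by_contra hcon
    push Not at hcon
    refine h.ne' ?_
    refine measure_mono_null (t := ⋃ z ∈ {z | 0 < (Measure.infinitePi fun _ : ℕ => ν)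
      {ω | path F z ω t = y}}, {ξ | F x ξ = z}) ?_ ?_
    · intro ξ hξ
      simp only [Set.mem_iUnion]
      exact ⟨F x ξ, pos_iff_ne_zero.2 hξ, rfl⟩
    · refine (measure_biUnion_null_iff (Set.to_countable _)).2 fun z hz => ?_
      by_contra h0
      exact absurd hz (not_lt.2 (hcon z (pos_iff_ne_zero.2 h0)))
  · rintro ⟨z, hz, hp⟩
    refine hz.trans_le (measure_mono ?_)
    rintro ξ rfl
    exact hp.ne'

theorem accessible_iff (hF : ∀ x y, MeasurableSet {ξ | F x ξ = y}) (x y : X) :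
    Accessible F ν x y ↔
      Relation.ReflTransGen (fun u v => 0 < ν {ξ | F u ξ = v}) x y := by
  constructor
  · rintro ⟨t, ht⟩
    induction t generalizing x with
    | zero =>
      have : x = y := by
        by_contra hne
        simp [path, hne] at ht
      rw [this]
    | succ t ih =>
      obtain ⟨z, hz, hp⟩ := (accessible_succ_iff hF x y t).1 ht
      exact Relation.ReflTransGen.head hz (ih z hp)
  · intro h
    induction h using Relation.ReflTransGen.head_induction_on with
    | refl => exact Accessible.refl y
    | head h1 _ ih =>
      obtain ⟨t, ht⟩ := ih
      exact ⟨t + 1, (accessible_succ_iff hF _ y t).2 ⟨_, h1, ht⟩⟩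

theorem Accessible.trans (hF : ∀ x y, MeasurableSet {ξ | F x ξ = y}) {x y z : X}
    (h1 : Accessible F ν x y) (h2 : Accessible F ν y z) : Accessible F ν x z :=
  (accessible_iff hF x z).2 (((accessible_iff hF x y).1 h1).trans ((accessible_iff hF y z).1 h2))

theorem ae_accessible_step (hF : ∀ x y, MeasurableSet {ξ | F x ξ = y}) {x y : X}
    (h : Accessible F ν x y) : ∀ᵐ ξ ∂ν, Accessible F ν x (F y ξ) := by
  filter_upwards [ae_step_pos (F := F) (ν := ν) y] with ξ hξ
  exact h.trans hF ((accessible_iff hF _ _).2 (Relation.ReflTransGen.single hξ))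

/-- The states accessible from `x` are almost surely never left. The old mean hitting time on them,
extended by `⊤`, is therefore a supersolution for the smaller target. -/
theorem meanHitTime_inter_accessible_le (hF : ∀ x y, MeasurableSet {ξ | F x ξ = y}) (C : Set X)
    {x y : X} (hy : Accessible F ν x y) :
    meanHitTime F ν y (C ∩ {z | Accessible F ν x z}) ≤ meanHitTime F ν y C := by
  classical
  have := meanHitTime_le_of_supersolution (ν := ν) hF (B := C ∩ {z | Accessible F ν x z})
    (h := fun z => if Accessible F ν x z then meanHitTime F ν z C else ⊤) ?_ y
  · simpa [hy] using this
  · intro z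
    by_cases hz : Accessible F ν x z
    · rw [if_pos hz, meanHitTime_eq hF z C]
      refine add_le_add le_rfl (lintegral_mono_ae ?_)
      filter_upwards [ae_accessible_step hF hz] with ξ hξ
      simp [Set.indicator_apply, hξ]
    · rw [if_neg hz]
      exact le_top

end Chain

/-! ### Foster's criterion without irreducibility -/

section Foster

variable {X E : Type*} [MeasurableSpace E] {F : X → E → X} {ν : Measure E}
  [IsProbabilityMeasure ν]

open Classical in
/-- The function whose integral over one step gives the probability that the chain visits `D ∪ {c}`
first at `c`, if `q` is this probability for the state after the step. -/
noncomputable def firstAt (c : X) (D : Set X) (q : X → ℝ≥0∞) (z : X) : ℝ≥0∞ :=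
  if z = c then 1 else if z ∈ D then 0 else q z

theorem firstAt_mono (c : X) (D : Set X) : Monotone (firstAt c D) := by
  intro q r h z
  unfold firstAt
  split_ifs
  · exact le_rfl
  · exact le_rfl
  · exact h z

variable [Countable X]

/-- If `D` is accessible from `c`, then the chain started at `c` returns to `c` before it
visits `D` with probability less than `1`. -/
theorem exists_firstAt_fixedPoint (hF : ∀ x y, MeasurableSet {ξ | F x ξ = y}) {c : X} {D : Set X}
    (hcD : c ∉ D) (hacc : ∃ y ∈ D, Accessible F ν c y) :
    ∃ q : X → ℝ≥0∞, (∀ x, q x = ∫⁻ ξ, firstAt c D q (F x ξ) ∂ν) ∧ (∀ x, q x ≤ 1) ∧ q c < 1 := by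
  -- The probability is taken as a least fixed point (Knaster–Tarski). It is at most `1` because the
  -- constant `1` is a supersolution.
  let Φ : (X → ℝ≥0∞) →o (X → ℝ≥0∞) :=
    ⟨fun q x => ∫⁻ ξ, firstAt c D q (F x ξ) ∂ν,
      fun q r h x => lintegral_mono fun ξ => firstAt_mono c D h (F x ξ)⟩
  have hfix : ∀ x, Φ.lfp x = ∫⁻ ξ, firstAt c D Φ.lfp (F x ξ) ∂ν :=
    fun x => (congrFun Φ.map_lfp x).symm
  have hfirst : ∀ {q : X → ℝ≥0∞}, (∀ x, q x ≤ 1) → ∀ z, firstAt c D q z ≤ 1 := by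
    intro q hq z
    unfold firstAt
    split_ifs
    · exact le_rfl
    · exact zero_le_one
    · exact hq z
  have hle : ∀ x, Φ.lfp x ≤ 1 := by
    refine Φ.lfp_le (a := fun _ => 1) fun x => ?_
    calc ∫⁻ ξ, firstAt c D (fun _ => 1) (F x ξ) ∂ν ≤ ∫⁻ _, 1 ∂ν :=
          lintegral_mono fun ξ => hfirst (fun _ => le_rfl) _
      _ = 1 := by simp
  refine ⟨Φ.lfp, hfix, hle, lt_of_le_of_ne (hle c) fun hc => ?_⟩
  -- An integrand bounded by `1` with mean `1` equals `1` almost surely. The value `1` at `c` would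
  -- thus spread to all states accessible from `c` and keep them out of `D`.
  have hstep : ∀ x, Φ.lfp x = 1 → ∀ y, 0 < ν {ξ | F x ξ = y} → y ∉ D ∧ Φ.lfp y = 1 := by
    intro x hx y hy
    have hae : (fun ξ => firstAt c D Φ.lfp (F x ξ)) =ᵐ[ν] fun _ => 1 := by
      refine ae_eq_of_ae_le_of_lintegral_le (Filter.Eventually.of_forall fun ξ => hfirst hle _)
        ?_ aemeasurable_const ?_
      · rw [← hfix x, hx]
        exact ENNReal.one_ne_top
      · rw [← hfix x, hx]
        simp
    have hval : firstAt c D Φ.lfp y = 1 := by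
      by_contra hne
      refine hy.ne' (measure_mono_null ?_ hae)
      rintro ξ rfl
      exact hne
    unfold firstAt at hval
    split_ifs at hval with h1 h2
    · exact ⟨h1 ▸ hcD, h1 ▸ hc⟩
    · exact absurd hval zero_ne_one
    · exact ⟨h2, hval⟩
  obtain ⟨y, hyD, hy⟩ := hacc
  have hall : y ∉ D ∧ Φ.lfp y = 1 := by
    have := (accessible_iff hF c y).1 hy
    clear hyD hy
    induction this with
    | refl => exact ⟨hcD, hc⟩
    | tail _ h ih => exact hstep _ ih.2 _ h
  exact hall.1 hyD

/-- Each visit to `c` starts a new attempt to reach `D`, which returns to `c` first with probability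
`q c < 1`. The attempts are dominated by a geometric series. -/
theorem meanHitTime_lt_top_of_insert (hF : ∀ x y, MeasurableSet {ξ | F x ξ = y}) {c : X}
    {D : Set X} (hacc : ∃ y ∈ D, Accessible F ν c y)
    (hc : meanHitTime F ν c (insert c D) < ⊤) {x : X}
    (hx : meanHitTime F ν x (insert c D) < ⊤) : meanHitTime F ν x D < ⊤ := by
  by_cases hcD : c ∈ D
  · rwa [Set.insert_eq_of_mem hcD] at hx
  obtain ⟨q, hq, hq1, hqc⟩ := exists_firstAt_fixedPoint hF hcD hacc
  set m : X → ℝ≥0∞ := fun y => meanHitTime F ν y (insert c D) with hm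
  -- `K` solves `m c + K * q c = K`: it is the cost of restarting from `c`.
  set K : ℝ≥0∞ := m c / (1 - q c) with hK
  have h1q : 1 - q c ≠ 0 := (tsub_pos_of_lt hqc).ne'
  have hKtop : K ≠ ⊤ := ENNReal.div_ne_top hc.ne h1q
  have hKeq : m c + K * q c ≤ K := by
    have h1 : K * (1 - q c) = m c :=
      ENNReal.div_mul_cancel h1q (ENNReal.sub_ne_top ENNReal.one_ne_top)
    rw [← h1, ← mul_add, tsub_add_cancel_of_le hqc.le, mul_one]
  have hsup := meanHitTime_le_of_supersolution (ν := ν) hF (B := D)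
    (h := fun y => m y + K * q y) ?_ x
  · refine hsup.trans_lt (ENNReal.add_lt_top.2 ⟨hx, ENNReal.mul_lt_top hKtop.lt_top ?_⟩)
    exact (hq1 x).trans_lt ENNReal.one_lt_top
  · intro y
    have hme : m y = 1 + ∫⁻ ξ, (insert c D)ᶜ.indicator m (F y ξ) ∂ν := meanHitTime_eq hF y _
    show _ ≤ m y + K * q y
    rw [hme, hq y, ← lintegral_const_mul K (measurable_comp_step hF (firstAt c D q) y), add_assoc,
      ← lintegral_add_left (measurable_comp_step hF _ y)]
    refine add_le_add le_rfl (lintegral_mono fun ξ => ?_)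
    generalize F y ξ = z
    by_cases hzc : z = c
    · subst hzc
      simpa [firstAt, hcD] using hKeq
    · by_cases hzD : z ∈ D <;> simp [firstAt, hzc, hzD]

/-- In a closed set of states from which a finite set `C` is reached in finite mean time, so is
every set that is accessible from all states of `C`. -/
theorem meanHitTime_lt_top_of_union (hF : ∀ x y, MeasurableSet {ξ | F x ξ = y}) {B R : Set X}
    (C : Finset X) (hCR : ∀ c ∈ C, c ∈ R) (hacc : ∀ c ∈ C, ∃ y ∈ B, Accessible F ν c y)
    (hfin : ∀ x ∈ R, meanHitTime F ν x (C ∪ B) < ⊤) :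
    ∀ x ∈ R, meanHitTime F ν x B < ⊤ := by
  classical
  induction C using Finset.induction_on with
  | empty => simpa using hfin
  | insert c C _ ih =>
    refine ih (fun d hd => hCR d (Finset.mem_insert_of_mem hd))
      (fun d hd => hacc d (Finset.mem_insert_of_mem hd)) fun x hx => ?_
    rw [Finset.coe_insert, Set.insert_union] at hfin
    obtain ⟨y, hy, hcy⟩ := hacc c (Finset.mem_insert_self c C)
    exact meanHitTime_lt_top_of_insert hF ⟨y, Or.inr hy, hcy⟩
      (hfin c (hCR c (Finset.mem_insert_self c C))) (hfin x hx)

/-- From an essential `x`, every accessible point of `C` leads back to `x`, so these points can be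
deleted from the target `C ∪ {x}`. For the second claim, every point of `C` must lead to an
essential state. -/
theorem positiveRecurrent_of_finite_set (hF : ∀ x y, MeasurableSet {ξ | F x ξ = y}) {C : Set X}
    (hC : C.Finite) (hfin : ∀ x, meanHitTime F ν x C < ⊤) : PositiveRecurrent F ν := by
  have hR : ∀ x y, Accessible F ν x y →
      meanHitTime F ν y (C ∩ {z | Accessible F ν x z}) < ⊤ :=
    fun x y h => (meanHitTime_inter_accessible_le hF C h).trans_lt (hfin y)
  have hCR : ∀ x, (C ∩ {z | Accessible F ν x z}).Finite := fun x => hC.subset Set.inter_subset_left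
  have hess : ∀ x, Essential F ν x → PositiveRecurrentState F ν x := by
    intro x hx
    refine meanHitTime_lt_top_of_union hF (B := {x}) (R := {z | Accessible F ν x z})
      (hCR x).toFinset ?_ ?_ ?_ x (Accessible.refl x)
    · intro c hc
      exact ((hCR x).mem_toFinset.1 hc).2
    · intro c hc
      exact ⟨x, rfl, hx c ((hCR x).mem_toFinset.1 hc).2⟩
    · intro y hy
      rw [Set.Finite.coe_toFinset]
      exact (meanHitTime_anti Set.subset_union_left y).trans_lt (hR x y hy)
  have hreach : ∀ x, ∃ c ∈ C, Accessible F ν x c := by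
    intro x
    by_contra hcon
    push Not at hcon
    have h0 : C ∩ {z | Accessible F ν x z} = ∅ :=
      Set.eq_empty_iff_forall_notMem.2 fun z hz => hcon z hz.1 hz.2
    have := hR x x (Accessible.refl x)
    rw [h0, meanHitTime_empty] at this
    exact lt_irrefl _ this
  refine ⟨hess, fun x => ?_⟩
  refine meanHitTime_lt_top_of_union hF (R := Set.univ) hC.toFinset (fun _ _ => trivial) ?_ ?_ x
    trivial
  · intro c _
    -- A point of `C` accessible from `c` whose own accessible part of `C` is minimal is essential:
    -- by minimality, any point of `C` reached from it leads back.
    obtain ⟨d, hd, hmin⟩ := (hCR c).exists_minimalFor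
      (fun d => ({z ∈ C | Accessible F ν d z} : Set X)) _ (hreach c)
    refine ⟨d, hess d fun y hy => ?_, hd.2⟩
    obtain ⟨e, heC, hye⟩ := hreach y
    have hde := hy.trans hF hye
    have hsub : ({z ∈ C | Accessible F ν e z} : Set X) ⊆ {z ∈ C | Accessible F ν d z} :=
      fun z hz => ⟨hz.1, hde.trans hF hz.2⟩
    have hed : Accessible F ν e d :=
      (hmin ⟨heC, hd.2.trans hF hde⟩ hsub ⟨hd.1, Accessible.refl d⟩).2
    exact hye.trans hF hed
  · intro y _
    rw [Set.Finite.coe_toFinset]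
    exact (meanHitTime_anti Set.subset_union_left y).trans_lt (hfin y)

/-- Foster's criterion. -/
theorem positiveRecurrent_of_drift (hF : ∀ x y, MeasurableSet {ξ | F x ξ = y}) {C : Set X}
    (hC : C.Finite) {V : X → ℝ} (hV : ∀ x, 0 ≤ V x)
    (hint : ∀ x, Integrable (fun ξ => V (F x ξ)) ν)
    (hdrift : ∀ x ∉ C, ∫ ξ, V (F x ξ) ∂ν + 1 ≤ V x) : PositiveRecurrent F ν := by
  classical
  refine positiveRecurrent_of_finite_set hF hC fun x => ?_
  have hI : ∀ x, ∫⁻ ξ, ENNReal.ofReal (V (F x ξ)) ∂ν = ENNReal.ofReal (∫ ξ, V (F x ξ) ∂ν) :=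
    fun x => (ofReal_integral_eq_lintegral_ofReal (hint x)
      (Filter.Eventually.of_forall fun ξ => hV _)).symm
  -- On `C` the drift bound is not available. There `V` is replaced by the cost of one step plus the
  -- mean of `V` after it, which is harmless because the indicator ignores values on `C`.
  have := meanHitTime_le_of_supersolution (ν := ν) hF (B := C)
    (h := fun y => ENNReal.ofReal (if y ∈ C then 1 + ∫ ξ, V (F y ξ) ∂ν else V y)) ?_ x
  · exact this.trans_lt ENNReal.ofReal_lt_top
  · intro y
    have hle : 1 + ∫⁻ ξ, Cᶜ.indicator (fun y => ENNReal.ofReal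
        (if y ∈ C then 1 + ∫ ξ, V (F y ξ) ∂ν else V y)) (F y ξ) ∂ν ≤
        ENNReal.ofReal (1 + ∫ ξ, V (F y ξ) ∂ν) := by
      rw [ENNReal.ofReal_add zero_le_one (integral_nonneg fun ξ => hV _), ENNReal.ofReal_one, ← hI y]
      refine add_le_add le_rfl (lintegral_mono fun ξ => ?_)
      by_cases h : F y ξ ∈ C <;> simp [h]
    refine hle.trans (ENNReal.ofReal_le_ofReal ?_)
    split_ifs with h
    · exact le_rfl
    · linarith [hdrift y h]

end Foster

/-! ### Elementary inequalities for the drift -/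

/-- Abel summation: a sum with antitone nonnegative weights is nonpositive if all initial sums of
the unweighted terms are. -/
theorem sum_mul_nonpos_of_antitone {n : ℕ} {b g : Fin n → ℝ} (hb : Antitone b) (hb0 : ∀ l, 0 ≤ b l)
    (hg : ∀ m, ∑ l ∈ Finset.Iic m, g l ≤ 0) : ∑ l, b l * g l ≤ 0 := by
  cases n with
  | zero => simp
  | succ n =>
    have key : ∀ m : Fin (n + 1),
        ∑ l ∈ Finset.Iic m, b l * g l ≤ b m * ∑ l ∈ Finset.Iic m, g l := by
      intro m
      induction m using Fin.induction with
      | zero =>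
        have : Finset.Iic (0 : Fin (n + 1)) = {0} := by
          ext x
          simp
        simp [this]
      | succ i ih =>
        have hI : Finset.Iic i.succ = insert i.succ (Finset.Iic i.castSucc) := by
          ext x
          simp only [Finset.mem_Iic, Finset.mem_insert, Fin.le_def, Fin.ext_iff, Fin.val_succ,
            Fin.val_castSucc]
          omega
        have hni : i.succ ∉ Finset.Iic i.castSucc := by
          simp [Fin.le_def]
        rw [hI, Finset.sum_insert hni, Finset.sum_insert hni, mul_add]
        -- Lowering the weight of a nonpositive prefix sum only increases the product.
        have h1 : b i.castSucc * ∑ l ∈ Finset.Iic i.castSucc, g l ≤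
            b i.succ * ∑ l ∈ Finset.Iic i.castSucc, g l :=
          mul_le_mul_of_nonpos_right (hb (Fin.castSucc_lt_succ).le) (hg _)
        linarith
    have hlast : Finset.Iic (Fin.last n) = Finset.univ := by
      ext x
      simp [Fin.le_last]
    have := key (Fin.last n)
    rw [hlast] at this
    refine this.trans (mul_nonpos_of_nonneg_of_nonpos (hb0 _) ?_)
    rw [← hlast]
    exact hg _

/-- Without truncation this is expansion of the square. If the queue empties, then `q ≤ c`, and the
constant absorbs all negative terms on the right. -/
theorem sq_add_mul_next_le {q b s c : ℕ} {A M : ℝ} (hb : b ≤ c) (hs : s ≤ c) (hA : |A| ≤ M) :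
    ((q + b - s : ℕ) : ℝ) ^ 2 + 2 * ((q + b - s : ℕ) : ℝ) * A ≤
      (q : ℝ) ^ 2 + 2 * q * (b - s + A) + (c ^ 2 + 2 * c * M) := by
  have hb' : (b : ℝ) ≤ c := by exact_mod_cast hb
  have hs' : (s : ℝ) ≤ c := by exact_mod_cast hs
  have hb0 : (0 : ℝ) ≤ b := b.cast_nonneg
  have hs0 : (0 : ℝ) ≤ s := s.cast_nonneg
  have hq0 : (0 : ℝ) ≤ q := q.cast_nonneg
  have hd : |(b : ℝ) - s| ≤ c := abs_le.2 ⟨by linarith, by linarith⟩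
  have hsq : ((b : ℝ) - s) ^ 2 ≤ c ^ 2 := sq_le_sq' (by linarith) (by linarith)
  rcases le_total s (q + b) with h | h
  · rw [Nat.cast_sub h, Nat.cast_add]
    have h1 : ((b : ℝ) - s) * A ≤ c * M := by
      refine (le_abs_self _).trans ?_
      rw [abs_mul]
      exact mul_le_mul hd hA (abs_nonneg _) (by linarith)
    nlinarith
  · rw [Nat.sub_eq_zero_of_le h]
    have hqc : (q : ℝ) ≤ c := by
      have : q ≤ c := by omega
      exact_mod_cast this
    have h1 : -((q : ℝ) * A) ≤ c * M := by
      refine (neg_le_abs _).trans ?_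
      rw [abs_mul, abs_of_nonneg hq0]
      exact mul_le_mul hqc hA (abs_nonneg _) (by linarith)
    push_cast
    nlinarith [sq_nonneg ((q : ℝ) + (b - s))]

theorem integral_affine_sub {Ω : Type*} [MeasurableSpace Ω] {P : Measure Ω}
    [IsProbabilityMeasure P] {Y Z : Ω → ℝ} (hY : Integrable Y P) (hZ : Integrable Z P)
    (a b A d : ℝ) :
    ∫ ω, (a + b * (Y ω - Z ω + A) + d) ∂P = a + b * (∫ ω, Y ω ∂P - ∫ ω, Z ω ∂P + A) + d := by
  have h0 : Integrable (fun ω => Y ω - Z ω) P := hY.sub hZ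
  have h1 : Integrable (fun ω => Y ω - Z ω + A) P := h0.add (integrable_const A)
  have h2 : Integrable (fun ω => b * (Y ω - Z ω + A)) P := h1.const_mul b
  have h3 : Integrable (fun ω => a + b * (Y ω - Z ω + A)) P := (integrable_const a).add h2
  rw [integral_add h3 (integrable_const d), integral_add (integrable_const a) h2,
    integral_const_mul, integral_add h0 (integrable_const A), integral_sub hY hZ]
  simp

namespace Policy

variable {n : ℕ} (π : Policy n)

/-! ### Measurability and integrability -/

theorem measurableSet_decide (μ : Fin n → ℝ) (q : Fin n → ℕ) (φ : Fin π.T → Fin n) :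
    MeasurableSet {p : I × I | π.decide μ q p.1 p.2 = φ} := by
  have : {p : I × I | π.decide μ q p.1 p.2 = φ} = ⋃ η : Equiv.Perm (Fin n),
      {v | π.L (fun l => (q l : ℝ≥0) / π.γ l) v = η} ×ˢ {w | π.Y η μ w = φ} := by
    ext p
    simp only [Set.mem_iUnion, Set.mem_prod]
    constructor
    · intro h
      exact ⟨_, rfl, h⟩
    · rintro ⟨η, h1, h2⟩
      change π.L _ _ = η at h1
      change π.Y η μ p.2 = φ at h2
      change π.Y _ μ p.2 = φ
      rw [h1, h2]
  rw [this]
  exact MeasurableSet.iUnion fun η => (π.L_measurable _ η).prod (π.Y_measurable η μ φ)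

theorem measurable_nextQueue (q : Fin n → ℕ) (j : Fin n) :
    Measurable fun ξ : Input n => nextQueue q j ξ.1 ξ.2.1 :=
  (Measurable.of_discrete (f := fun p : ℕ × (Fin n → ℕ) => nextQueue q j p.1 p.2)).comp
    (measurable_fst.prodMk (measurable_fst.comp measurable_snd))

theorem step_of_lt (μ : Fin n → ℝ) (x : π.State) (ξ : Input n) (h : (x.2.2 : ℕ) + 1 < π.T) :
    π.step μ x ξ = (nextQueue x.1 (x.2.1 x.2.2) ξ.1 ξ.2.1, x.2.1, ⟨x.2.2 + 1, h⟩) := by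
  simp only [step, dif_pos h]

theorem step_of_not_lt (μ : Fin n → ℝ) (x : π.State) (ξ : Input n)
    (h : ¬(x.2.2 : ℕ) + 1 < π.T) :
    π.step μ x ξ = (nextQueue x.1 (x.2.1 x.2.2) ξ.1 ξ.2.1,
      π.decide μ (nextQueue x.1 (x.2.1 x.2.2) ξ.1 ξ.2.1) ξ.2.2.1 ξ.2.2.2, ⟨0, π.T_pos⟩) := by
  simp only [step, dif_neg h]

theorem step_fst (μ : Fin n → ℝ) (x : π.State) (ξ : Input n) :
    (π.step μ x ξ).1 = nextQueue x.1 (x.2.1 x.2.2) ξ.1 ξ.2.1 := by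
  by_cases h : (x.2.2 : ℕ) + 1 < π.T
  · rw [step_of_lt π μ x ξ h]
  · rw [step_of_not_lt π μ x ξ h]

theorem measurableSet_step (μ : Fin n → ℝ) (x y : π.State) :
    MeasurableSet {ξ | π.step μ x ξ = y} := by
  have hq : MeasurableSet {ξ : Input n | nextQueue x.1 (x.2.1 x.2.2) ξ.1 ξ.2.1 = y.1} :=
    measurable_nextQueue x.1 _ (measurableSet_singleton y.1)
  by_cases h : (x.2.2 : ℕ) + 1 < π.T
  · have : {ξ | π.step μ x ξ = y} = {ξ : Input n | nextQueue x.1 (x.2.1 x.2.2) ξ.1 ξ.2.1 = y.1} ∩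
        {_ξ | (x.2.1, (⟨x.2.2 + 1, h⟩ : Fin π.T)) = y.2} := by
      ext ξ
      change π.step μ x ξ = y ↔ _ = y.1 ∧ _ = y.2
      rw [step_of_lt π μ x ξ h, Prod.ext_iff]
    rw [this]
    exact hq.inter (MeasurableSet.const _)
  · have : {ξ | π.step μ x ξ = y} = {ξ : Input n | nextQueue x.1 (x.2.1 x.2.2) ξ.1 ξ.2.1 = y.1} ∩
        ((fun ξ : Input n => ξ.2.2) ⁻¹' {p : I × I | π.decide μ y.1 p.1 p.2 = y.2.1} ∩
        {_ξ | (⟨0, π.T_pos⟩ : Fin π.T) = y.2.2}) := by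
      ext ξ
      change π.step μ x ξ = y ↔ _ = y.1 ∧ π.decide μ y.1 ξ.2.2.1 ξ.2.2.2 = y.2.1 ∧ _ = y.2.2
      rw [step_of_not_lt π μ x ξ h, Prod.ext_iff, Prod.ext_iff]
      refine and_congr_right fun h1 => ?_
      change nextQueue x.1 (x.2.1 x.2.2) ξ.1 ξ.2.1 = y.1 at h1
      rw [h1]
    rw [this]
    exact hq.inter (((measurable_snd.comp measurable_snd) (π.measurableSet_decide μ y.1 y.2.1)).inter
      (MeasurableSet.const _))

theorem finite_setOf_queue_le (N : Fin n → ℕ) : {x : π.State | x.1 ≤ N}.Finite := by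
  have : {x : π.State | x.1 ≤ N} = Set.Iic N ×ˢ Set.univ := by
    ext x
    simp
  rw [this]
  exact (Set.finite_Iic N).prod Set.finite_univ

variable {α : Measure ℕ} {β : Measure (Fin n → ℕ)}

theorem measurePreserving_arrivals [SFinite α] [IsProbabilityMeasure β] :
    MeasurePreserving (fun ξ : Input n => ξ.1) (inputLaw α β) α :=
  measurePreserving_fst

theorem measurePreserving_services [IsProbabilityMeasure α] [SFinite β] :
    MeasurePreserving (fun ξ : Input n => ξ.2.1) (inputLaw α β) β :=
  measurePreserving_fst.comp measurePreserving_snd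

theorem nextQueue_le {q : Fin n → ℕ} {j : Fin n} {a c : ℕ} {s : Fin n → ℕ} (ha : a ≤ c) :
    nextQueue q j a s ≤ fun l => q l + c := by
  intro l
  simp only [nextQueue]
  split_ifs <;> omega

variable [IsProbabilityMeasure α] [IsProbabilityMeasure β]

theorem integrable_step (μ : Fin n → ℝ) {c : ℕ} (hα : ∀ᵐ a ∂α, a ≤ c) (x : π.State)
    (h : π.State → ℝ) : Integrable (fun ξ => h (π.step μ x ξ)) (inputLaw α β) := by
  refine integrable_comp_of_ae_mem_finite (π.measurableSet_step μ x)
    (π.finite_setOf_queue_le fun l => x.1 l + c) ?_ h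
  filter_upwards [measurePreserving_arrivals.quasiMeasurePreserving.ae hα] with ξ hξ
  rw [step_fst]
  exact nextQueue_le hξ

/-! ### The Lyapunov function -/

/-- The expected change of queue `l` in the slots `i ∈ J` of a cycle with decisions `φ`, raised
by `δ` per slot, if the mean number of arrivals per slot is `Λ` and idling is ignored. -/
def netInput (Λ δ : ℝ) (μ : Fin n → ℝ) (φ : Fin π.T → Fin n) (J : Finset (Fin π.T)) (l : Fin n) : ℝ :=
  ∑ j ∈ J, ((if l = φ j then Λ else 0) - μ l + δ)

/-- The weighted sum of squared queue lengths, corrected by the expected changes in the rest of the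
cycle. -/
noncomputable def lyapunov (Λ δ : ℝ) (μ : Fin n → ℝ) (x : π.State) : ℝ :=
  ∑ l, ((x.1 l : ℝ) ^ 2 + 2 * x.1 l * π.netInput Λ δ μ x.2.1 (Finset.Ici x.2.2) l) / π.γ l

theorem exists_netInput_bound (Λ δ : ℝ) (μ : Fin n → ℝ) :
    ∃ M : ℝ, ∀ φ J l, |π.netInput Λ δ μ φ J l| ≤ M := by
  obtain ⟨M, hM⟩ := (Set.finite_range fun z : (Fin π.T → Fin n) × Finset (Fin π.T) × Fin n =>
    |π.netInput Λ δ μ z.1 z.2.1 z.2.2|).bddAbove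
  exact ⟨M, fun φ J l => hM ⟨(φ, J, l), rfl⟩⟩

theorem exists_lyapunov_bound (Λ δ : ℝ) (μ : Fin n → ℝ) :
    ∃ K : ℝ, ∀ x, 0 ≤ π.lyapunov Λ δ μ x + K := by
  obtain ⟨M, hM⟩ := π.exists_netInput_bound Λ δ μ
  -- The constant completes the squares, since each correction is at most `M` in absolute value.
  refine ⟨∑ l, M ^ 2 / π.γ l, fun x => ?_⟩
  rw [lyapunov, ← Finset.sum_add_distrib]
  refine Finset.sum_nonneg fun l _ => ?_
  rw [← add_div]
  refine div_nonneg ?_ (π.γ l).2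
  have h1 := sq_le_sq' (abs_le.1 (hM x.2.1 (Finset.Ici x.2.2) l)).1
    (abs_le.1 (hM x.2.1 (Finset.Ici x.2.2) l)).2
  nlinarith [sq_nonneg ((x.1 l : ℝ) + π.netInput Λ δ μ x.2.1 (Finset.Ici x.2.2) l)]

/-- The drift in one slot, with fixed values `A l` in place of the expected changes in the
rest of the cycle. -/
theorem integral_sq_add_mul_next_le (μ : Fin n → ℝ) {c : ℕ} (hα : ∀ᵐ a ∂α, a ≤ c)
    (hβ : ∀ᵐ s ∂β, ∀ l, s l ≤ c) (hμ : ∀ l, ∫ s, (s l : ℝ) ∂β = μ l) {A : Fin n → ℝ} {M : ℝ}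
    (hA : ∀ l, |A l| ≤ M) (x : π.State) :
    ∫ ξ, ∑ l, (((π.step μ x ξ).1 l : ℝ) ^ 2 + 2 * (π.step μ x ξ).1 l * A l) / π.γ l
        ∂(inputLaw α β) ≤
      ∑ l, ((x.1 l : ℝ) ^ 2 + 2 * x.1 l *
        ((if l = x.2.1 x.2.2 then ∫ a, (a : ℝ) ∂α else 0) - μ l + A l) +
          (c ^ 2 + 2 * c * M)) / π.γ l := by
  have hia : Integrable (fun ξ : Input n => (ξ.1 : ℝ)) (inputLaw α β) := by
    refine Integrable.of_bound (measurable_from_top.comp measurable_fst).aestronglyMeasurable c ?_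
    filter_upwards [measurePreserving_arrivals.quasiMeasurePreserving.ae hα] with ξ hξ
    simpa using hξ
  have his : ∀ l, Integrable (fun ξ : Input n => (ξ.2.1 l : ℝ)) (inputLaw α β) := by
    intro l
    refine Integrable.of_bound (measurable_from_top.comp ((measurable_pi_apply l).comp
      (measurable_fst.comp measurable_snd))).aestronglyMeasurable c ?_
    filter_upwards [measurePreserving_services.quasiMeasurePreserving.ae hβ] with ξ hξ
    simpa using hξ l
  have hEa : ∫ ξ, (ξ.1 : ℝ) ∂(inputLaw α β) = ∫ a, (a : ℝ) ∂α := by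
    have h := measurePreserving_arrivals (α := α) (β := β)
    have h1 := integral_map (μ := inputLaw α β) (f := fun a : ℕ => (a : ℝ)) h.measurable.aemeasurable
      measurable_from_top.aestronglyMeasurable
    rw [h.map_eq] at h1
    exact h1.symm
  have hEs : ∀ l, ∫ ξ, (ξ.2.1 l : ℝ) ∂(inputLaw α β) = μ l := by
    intro l
    have h := measurePreserving_services (α := α) (β := β)
    have h1 := integral_map (μ := inputLaw α β) (f := fun s : Fin n → ℕ => (s l : ℝ)) h.measurable.aemeasurable
      Measurable.of_discrete.aestronglyMeasurable
    rw [h.map_eq] at h1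
    rw [← hμ l]
    exact h1.symm
  have hib : ∀ l, Integrable (fun ξ : Input n => if l = x.2.1 x.2.2 then (ξ.1 : ℝ) else 0)
      (inputLaw α β) := by
    intro l
    split_ifs
    · exact hia
    · exact integrable_zero _ _ _
  have hid : ∀ l, Integrable (fun ξ : Input n => (x.1 l : ℝ) ^ 2 + 2 * x.1 l *
      ((if l = x.2.1 x.2.2 then (ξ.1 : ℝ) else 0) - ξ.2.1 l + A l) + (c ^ 2 + 2 * c * M))
      (inputLaw α β) :=
    fun l => ((integrable_const _).add ((((hib l).sub (his l)).add
      (integrable_const _)).const_mul _)).add (integrable_const _)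
  calc _ ≤ ∫ ξ, ∑ l, ((x.1 l : ℝ) ^ 2 + 2 * x.1 l *
        ((if l = x.2.1 x.2.2 then (ξ.1 : ℝ) else 0) - ξ.2.1 l + A l) + (c ^ 2 + 2 * c * M)) /
          π.γ l ∂(inputLaw α β) := by
        refine integral_mono_ae (π.integrable_step μ hα x fun y =>
            ∑ l, ((y.1 l : ℝ) ^ 2 + 2 * y.1 l * A l) / π.γ l)
          (integrable_finsetSum _ fun l _ => (hid l).div_const _) ?_
        filter_upwards [measurePreserving_arrivals.quasiMeasurePreserving.ae hα,
          measurePreserving_services.quasiMeasurePreserving.ae hβ] with ξ h1 h2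
        refine Finset.sum_le_sum fun l _ => div_le_div_of_nonneg_right ?_ (π.γ l).2
        rw [step_fst, nextQueue]
        have h3 : (if l = x.2.1 x.2.2 then ξ.1 else 0) ≤ c := by
          split_ifs
          · exact h1
          · exact Nat.zero_le _
        have := sq_add_mul_next_le (q := x.1 l) h3 (h2 l) (hA l)
        simpa using this
    _ = _ := by
        rw [integral_finsetSum _ fun l _ => (hid l).div_const _]
        refine Finset.sum_congr rfl fun l _ => ?_
        rw [integral_div, integral_affine_sub (hib l) (his l), hEs l]
        split_ifs
        · rw [hEa]
        · rw [integral_zero]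

end Policy

/-! ### One-slot drift of the Lyapunov function -/

namespace Policy

variable {n : ℕ} (π : Policy n)

theorem netInput_Ici_eq_add (Λ δ : ℝ) (μ : Fin n → ℝ) (φ : Fin π.T → Fin n) (i : Fin π.T)
    (l : Fin n) : π.netInput Λ δ μ φ (Finset.Ici i) l =
      ((if l = φ i then Λ else 0) - μ l + δ) + π.netInput Λ δ μ φ (Finset.Ioi i) l := by
  classical
  rw [netInput, netInput, ← Finset.Ioi_insert i, Finset.sum_insert (by simp)]

theorem netInput_univ (Λ δ : ℝ) (μ : Fin n → ℝ) (η : Equiv.Perm (Fin n)) (w : I) (l : Fin n) :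
    π.netInput Λ δ μ (π.Y η μ w) Finset.univ (η l) =
      Λ * π.slotCount μ η w l + π.T * (δ - μ (η l)) := by
  simp only [netInput, slotCount, sub_add, Finset.sum_sub_distrib, Finset.sum_const,
    Finset.card_univ, Fintype.card_fin, nsmul_eq_mul, Finset.natCast_card_filter, Finset.mul_sum]
  rw [sub_eq_add_neg, neg_sub, ← mul_sub]
  congr 1
  refine Finset.sum_congr rfl fun j _ => ?_
  rw [mul_ite, mul_one, mul_zero]
  exact if_congr eq_comm rfl rfl

theorem integral_netInput_univ (Λ δ : ℝ) (μ : Fin n → ℝ) (η : Equiv.Perm (Fin n)) (l : Fin n) :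
    ∫ w, π.netInput Λ δ μ (π.Y η μ w) Finset.univ (η l) =
      π.T * (Λ * π.f μ l η - μ (η l) + δ) := by
  have hT : (π.T : ℝ) ≠ 0 := by exact_mod_cast π.T_pos.ne'
  have hint : Integrable (fun w => (π.slotCount μ η w l : ℝ)) (volume : Measure I) :=
    integrable_comp_of_ae_mem_finite (π.Y_measurable η μ) Set.finite_univ
      (Filter.Eventually.of_forall fun _ => Set.mem_univ _)
      fun φ => ((Finset.univ.filter fun j : Fin π.T => φ j = η l).card : ℝ)
  simp_rw [netInput_univ]
  rw [integral_add (hint.const_mul Λ) (integrable_const _), integral_const_mul, f, integral_div]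
  simp only [integral_const, probReal_univ, one_smul]
  field_simp
  ring

/-- When a new cycle starts, the expected net input of the cycle is nonpositive in the sense
weighted by the scaled queue lengths. -/
theorem integral_sum_netInput_nonpos {Λ δ : ℝ} {μ : Fin n → ℝ} (hΛ : 0 ≤ Λ)
    (hδ : ∀ l, δ ≤ (1 - Λ / ∑ k, μ k) * μ l)
    (hf : ∀ (m : Fin n) (η : Equiv.Perm (Fin n)),
      ∑ l ∈ Finset.Iic m, π.f μ l η ≤ (∑ l ∈ Finset.Iic m, μ (η l)) / ∑ l, μ (η l))
    (q : Fin n → ℕ) (v : I) :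
    ∫ w, ∑ l, (2 * (q l : ℝ) * π.netInput Λ δ μ (π.decide μ q v w) Finset.univ l) / π.γ l ≤ 0 := by
  set o : Fin n → ℝ≥0 := fun l => (q l : ℝ≥0) / π.γ l with ho
  set η := π.L o v with hη
  have hdec : ∀ w, π.decide μ q v w = π.Y η μ w := fun w => rfl
  have hint : ∀ l, Integrable (fun w => π.netInput Λ δ μ (π.Y η μ w) Finset.univ l)
      (volume : Measure I) := fun l =>
    integrable_comp_of_ae_mem_finite (π.Y_measurable η μ) Set.finite_univ
      (Filter.Eventually.of_forall fun _ => Set.mem_univ _)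
      fun φ => π.netInput Λ δ μ φ Finset.univ l
  have hsum : ∀ w, ∑ l, (2 * (q l : ℝ) * π.netInput Λ δ μ (π.decide μ q v w) Finset.univ l) /
      π.γ l = ∑ l, 2 * (o (η l) : ℝ) * π.netInput Λ δ μ (π.Y η μ w) Finset.univ (η l) := by
    intro w
    rw [← Equiv.sum_comp η]
    refine Finset.sum_congr rfl fun l _ => ?_
    rw [hdec, ho]
    push_cast
    ring
  simp_rw [hsum]
  rw [integral_finsetSum _ fun l _ => (hint (η l)).const_mul _]
  simp_rw [integral_const_mul, integral_netInput_univ]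
  have hkey : ∑ l, (o (η l) : ℝ) * (Λ * π.f μ l η - μ (η l) + δ) ≤ 0 := by
    refine sum_mul_nonpos_of_antitone (fun i j hij => ?_) (fun l => (o (η l)).2) fun m => ?_
    · exact_mod_cast π.L_sorted o v i j hij
    -- With `r = Λ / ∑ μ`, the prefix sum is at most `(r - 1 + (1 - r))` times the prefix sum of the
    -- rates, that is, `0`.
    · have h1 := hf m η
      rw [Equiv.sum_comp η] at h1
      have h2 := mul_le_mul_of_nonneg_left h1 hΛ
      have h3 : ∑ l ∈ Finset.Iic m, δ ≤ ∑ l ∈ Finset.Iic m, (1 - Λ / ∑ k, μ k) * μ (η l) :=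
        Finset.sum_le_sum fun l _ => hδ (η l)
      rw [← Finset.mul_sum] at h3
      rw [Finset.sum_add_distrib, Finset.sum_sub_distrib, ← Finset.mul_sum]
      have h4 : Λ * ((∑ l ∈ Finset.Iic m, μ (η l)) / ∑ k, μ k) =
          Λ / (∑ k, μ k) * ∑ l ∈ Finset.Iic m, μ (η l) := by ring
      linarith
  calc ∑ l, 2 * (o (η l) : ℝ) * (π.T * (Λ * π.f μ l η - μ (η l) + δ))
      = 2 * π.T * ∑ l, (o (η l) : ℝ) * (Λ * π.f μ l η - μ (η l) + δ) := by
        rw [Finset.mul_sum]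
        exact Finset.sum_congr rfl fun l _ => by ring
    _ ≤ 0 := mul_nonpos_of_nonneg_of_nonpos (by positivity) hkey

variable {α : Measure ℕ} {β : Measure (Fin n → ℕ)}

/-- Only the decision variable needs averaging: arrivals, services and the sorting variable may stay
fixed. -/
theorem integral_inputLaw_nonpos [SFinite α] [SFinite β] {h : Input n → ℝ} (hint : Integrable h (inputLaw α β))
    (hh : ∀ a s v, ∫ w, h (a, s, v, w) ≤ 0) : ∫ ξ, h ξ ∂(inputLaw α β) ≤ 0 := by
  rw [inputLaw, integral_prod h hint]
  refine integral_nonpos_of_ae ?_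
  filter_upwards [hint.prod_right_ae] with a ha
  rw [integral_prod _ ha]
  refine integral_nonpos_of_ae ?_
  filter_upwards [ha.prod_right_ae] with s hs
  rw [integral_prod _ hs]
  exact integral_nonpos fun v => hh a s v

variable [IsProbabilityMeasure α] [IsProbabilityMeasure β]

/-- The drift of the Lyapunov function in one slot: up to a constant, it is at most a negative
multiple of the total scaled queue length. -/
theorem integral_lyapunov_step_le {δ : ℝ} {μ : Fin n → ℝ} {c : ℕ} (hα : ∀ᵐ a ∂α, a ≤ c)
    (hβ : ∀ᵐ s ∂β, ∀ l, s l ≤ c) (hμ : ∀ l, ∫ s, (s l : ℝ) ∂β = μ l)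
    (hδ : ∀ l, δ ≤ (1 - (∫ a, (a : ℝ) ∂α) / ∑ k, μ k) * μ l)
    (hf : ∀ (m : Fin n) (η : Equiv.Perm (Fin n)),
      ∑ l ∈ Finset.Iic m, π.f μ l η ≤ (∑ l ∈ Finset.Iic m, μ (η l)) / ∑ l, μ (η l)) :
    ∃ K : ℝ, ∀ x, ∫ ξ, π.lyapunov (∫ a, (a : ℝ) ∂α) δ μ (π.step μ x ξ) ∂(inputLaw α β) ≤
      π.lyapunov (∫ a, (a : ℝ) ∂α) δ μ x - 2 * δ * ∑ l, (x.1 l : ℝ) / π.γ l + K := by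
  set Λ : ℝ := ∫ a, (a : ℝ) ∂α with hΛ
  have hΛ0 : 0 ≤ Λ := integral_nonneg fun a => a.cast_nonneg
  obtain ⟨M, hM⟩ := π.exists_netInput_bound Λ δ μ
  refine ⟨∑ l, ((c : ℝ) ^ 2 + 2 * c * M) / π.γ l, fun x => ?_⟩
  have hmain := integral_sq_add_mul_next_le π μ hα hβ hμ
    (A := π.netInput Λ δ μ x.2.1 (Finset.Ioi x.2.2)) (M := M) (hM _ _) x
  have hrhs : ∑ l, ((x.1 l : ℝ) ^ 2 + 2 * x.1 l * ((if l = x.2.1 x.2.2 then Λ else 0) - μ l +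
      π.netInput Λ δ μ x.2.1 (Finset.Ioi x.2.2) l) + (c ^ 2 + 2 * c * M)) / π.γ l =
      π.lyapunov Λ δ μ x - 2 * δ * ∑ l, (x.1 l : ℝ) / π.γ l +
        ∑ l, ((c : ℝ) ^ 2 + 2 * c * M) / π.γ l := by
    rw [lyapunov, Finset.mul_sum, ← Finset.sum_sub_distrib, ← Finset.sum_add_distrib]
    refine Finset.sum_congr rfl fun l _ => ?_
    rw [netInput_Ici_eq_add]
    ring
  rw [← hΛ, hrhs] at hmain
  refine le_trans ?_ hmain
  -- Inside a cycle, the slots strictly after the present one are those from the next position on,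
  -- so the two integrands coincide.
  by_cases h : (x.2.2 : ℕ) + 1 < π.T
  · refine le_of_eq (integral_congr_ae (Filter.Eventually.of_forall fun ξ => ?_))
    have hI : Finset.Ici (⟨x.2.2 + 1, h⟩ : Fin π.T) = Finset.Ioi x.2.2 := by
      ext j
      simp only [Finset.mem_Ici, Finset.mem_Ioi, Fin.le_def, Fin.lt_def]
      omega
    simp only [lyapunov, step_of_lt π μ x ξ h, hI]
  -- At the end of a cycle nothing remains of the old correction. The integrands differ by the
  -- full-cycle correction, taken at the queues just sampled.
  · have hI : Finset.Ioi x.2.2 = ∅ := by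
      ext j
      simp only [Finset.mem_Ioi, Fin.lt_def, Finset.notMem_empty, iff_false]
      omega
    set A := π.netInput Λ δ μ x.2.1 (Finset.Ioi x.2.2) with hA
    have hA0 : ∀ l, A l = 0 := by
      intro l
      rw [hA, hI, netInput, Finset.sum_empty]
    have hint1 := π.integrable_step (β := β) μ hα x (π.lyapunov Λ δ μ)
    have hint2 := π.integrable_step (β := β) μ hα x
      fun y => ∑ l, ((y.1 l : ℝ) ^ 2 + 2 * y.1 l * A l) / π.γ l
    rw [← sub_nonpos, ← integral_sub hint1 hint2]
    refine integral_inputLaw_nonpos (hint1.sub hint2) fun a s v => ?_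
    refine le_of_eq_of_le (integral_congr_ae (Filter.Eventually.of_forall fun w => ?_))
      (π.integral_sum_netInput_nonpos hΛ0 hδ hf
        (nextQueue x.1 (x.2.1 x.2.2) a s) v)
    have hU : Finset.Ici (⟨0, π.T_pos⟩ : Fin π.T) = Finset.univ := by
      ext j
      simp [Fin.le_def]
    simp only [lyapunov, step_of_not_lt π μ x _ h, hU, hA0, ← Finset.sum_sub_distrib]
    refine Finset.sum_congr rfl fun l _ => ?_
    ring

theorem finite_setOf_sum_le (R : ℝ) : {x : π.State | ∑ l, (x.1 l : ℝ) / π.γ l ≤ R}.Finite := by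
  refine (π.finite_setOf_queue_le fun l => ⌈R * π.γ l⌉₊).subset fun x hx l => ?_
  have hγ : (0 : ℝ) < π.γ l := π.γ_pos l
  have h1 : (x.1 l : ℝ) / π.γ l ≤ R :=
    (Finset.single_le_sum (f := fun l => (x.1 l : ℝ) / π.γ l)
      (fun k _ => div_nonneg (Nat.cast_nonneg _) (π.γ k).2) (Finset.mem_univ l)).trans hx
  exact_mod_cast ((div_le_iff₀ hγ).1 h1).trans (Nat.le_ceil _)

end Policy

end LoadBalancing

/-! ### Throughput optimality -/

theorem corollary1 {n : ℕ} (π : LoadBalancing.Policy n)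
    (β : Measure (Fin n → ℕ)) [IsProbabilityMeasure β]
    (hβ : ∃ c : ℕ, ∀ᵐ s ∂β, ∀ l, s l ≤ c)
    (μ : Fin n → ℝ) (hμ_pos : ∀ l, 0 < μ l) (hμ : ∀ l, ∫ s, (s l : ℝ) ∂β = μ l)
    (hf : ∀ (m : Fin n) (η : Equiv.Perm (Fin n)),
      ∑ l ∈ Finset.Iic m, π.f μ l η ≤ (∑ l ∈ Finset.Iic m, μ (η l)) / ∑ l, μ (η l)) :
    π.ThroughputOptimal μ β := by
  intro lam hlam hlt α _ ⟨c₁, hα⟩ hmean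
  obtain ⟨c₂, hβ⟩ := hβ
  have hS : 0 < ∑ l, μ l := lt_of_le_of_lt (by positivity) hlt
  have hne : Nonempty (Fin n) := by
    by_contra hemp
    rw [not_nonempty_iff] at hemp
    simp at hS
  obtain ⟨l₀, hl₀⟩ := Finite.exists_min μ
  -- The smallest service rate times the unused fraction of capacity, so that one positive `δ`
  -- serves all queues.
  set δ : ℝ := (1 - (∫ a, (a : ℝ) ∂α) / ∑ k, μ k) * μ l₀ with hδ
  have hfac : 0 < 1 - (∫ a, (a : ℝ) ∂α) / ∑ k, μ k := by
    rw [hmean, sub_pos, div_lt_one hS]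
    exact hlt
  have hδ0 : 0 < δ := mul_pos hfac (hμ_pos l₀)
  obtain ⟨K, hK⟩ := π.integral_lyapunov_step_le (c := max c₁ c₂)
    (hα.mono fun a ha => ha.trans (le_max_left _ _))
    (hβ.mono fun s hs l => (hs l).trans (le_max_right _ _)) hμ
    (fun l => mul_le_mul_of_nonneg_left (hl₀ l) hfac.le) hf
  obtain ⟨K', hK'⟩ := π.exists_lyapunov_bound (∫ a, (a : ℝ) ∂α) δ μ
  have hint := fun x => π.integrable_step (β := β) μ hα x (π.lyapunov (∫ a, (a : ℝ) ∂α) δ μ)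
  -- Beyond the threshold `(K + 1) / (2 * δ)` the drift is below `-1`. Adding `K'` makes the
  -- Lyapunov function nonnegative and leaves the drift unchanged.
  refine LoadBalancing.positiveRecurrent_of_drift (π.measurableSet_step μ)
    (π.finite_setOf_sum_le ((K + 1) / (2 * δ))) hK'
    (fun x => (hint x).add (integrable_const _)) fun x hx => ?_
  rw [integral_add (hint x) (integrable_const _)]
  simp only [integral_const, probReal_univ, one_smul]
  have hx' : (K + 1) / (2 * δ) < ∑ l, (x.1 l : ℝ) / π.γ l := not_le.1 hx
  rw [div_lt_iff₀ (by positivity)] at hx'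
  have := hK x
  rw [← hδ] at this
  linarith
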